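/- Let $K_n$ be the complete graph on the vertex set $[n]$. A Hamilton path in $K_n$ is regarded as an (undirected) graph with vertex set $[n]$, and the union of two such paths is the graph on $[n]$ whose edge set is the union of their edge sets. Let $M(n,4)$ denote the maximum cardinality of a family of Hamilton paths in $K_n$ such that the union of any two different members of the family contains a cycle of length $4$. Then $$\lfloor n/2\rfloor!\;\leq\; M(n,4)\qquad\text{for all } n\ge 1,$$ and $$M(n,4)\;\leq\; n^{\frac{3n}{4}+O\left(\frac{n}{\log n}\right)},$$ that is, there is an absolute constant $C$ such that $M(n,4)\le n^{3n/4+Cn/\log n}$ for all $n\ge 2$. -/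

import Mathlib

/-- A graph on the vertex set `Fin n`, regarded as a subgraph of `K_n`, is a Hamilton path if it is
a path on all the `n` vertices (undirected: a path and its reversal are the same graph). -/
def IsHamiltonPath {n : ℕ} (G : SimpleGraph (Fin n)) : Prop :=
  Nonempty (SimpleGraph.pathGraph n ≃g G)

/-- `G` contains a cycle of length `k` (as a not necessarily induced subgraph); for `k ≥ 3`. -/
def ContainsCycle (k : ℕ) {V : Type*} (G : SimpleGraph V) : Prop :=
  (SimpleGraph.cycleGraph k).IsContained G

/-- A family of Hamilton paths in `K_n` such that the union of any two different members
contains a cycle of length `k`. -/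
def IsSeparatedFamily (n k : ℕ) (F : Finset (SimpleGraph (Fin n))) : Prop :=
  (∀ G ∈ F, IsHamiltonPath G) ∧ ∀ G ∈ F, ∀ H ∈ F, G ≠ H → ContainsCycle k (G ⊔ H)

/-- `M(n, k)`: the maximum cardinality of such a family. It is attained, since there are only
finitely many graphs on `Fin n` and the empty family qualifies. -/
noncomputable def maxSeparated (n k : ℕ) : ℕ :=
  sSup {m : ℕ | ∃ F : Finset (SimpleGraph (Fin n)), IsSeparatedFamily n k F ∧ F.card = m}

/-! Upper bound: take a host graph on N vertices without 4-cycles. A self-avoiding walk on n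
vertices in the host, laid along a member of the family, is an injection embedding that member in
the host. No injection embeds two members, whose union has a 4-cycle, so |F| times the number of
walks is at most N^n (`IsSeparatedFamily.card_mul_card_le`). For k about √n and a prime q with 4k <
q ≤ 8k, the polarity graph has q² ≤ 64k² vertices and at least k^n walks
(`pow_le_card_extendableWalks`). Hence |F| ≤ (64k)^n, which is n^(n/2 + O(n/log n)), better than
required.

Lower bound: fix the vertices at even positions of a path and permute the others. Where two
permutations differ, two fixed vertices have a different middle vertex in each path, which closes a
4-cycle. -/

open Finset

/-! ### Counting self-avoiding walks in graphs without 4-cycles -/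

section SelfAvoidingWalks

variable {V : Type*} [Fintype V] [DecidableEq V] (H : SimpleGraph V) [DecidableRel H.Adj]

/-- Any two distinct vertices have at most one common neighbour. -/
def AtMostOneCommonNeighbor {V : Type*} (H : SimpleGraph V) : Prop :=
  ∀ u v a b : V, u ≠ v → H.Adj u a → H.Adj v a → H.Adj u b → H.Adj v b → a = b

theorem ContainsCycle.exists_common_neighbors {V : Type*} {G : SimpleGraph V}
    (h : ContainsCycle 4 G) : ∃ u v a b : V, u ≠ v ∧ a ≠ b ∧
      G.Adj u a ∧ G.Adj v a ∧ G.Adj u b ∧ G.Adj v b := by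
  obtain ⟨f⟩ := h
  have adj : ∀ i j : Fin 4, (SimpleGraph.cycleGraph 4).Adj i j → G.Adj (f i) (f j) :=
    fun i j hij => f.toHom.map_adj hij
  refine ⟨f 0, f 2, f 1, f 3, f.injective.ne (by decide), f.injective.ne (by decide),
    adj _ _ ?_, adj _ _ ?_, adj _ _ ?_, adj _ _ ?_⟩ <;>
  (rw [SimpleGraph.cycleGraph_adj]; decide)

theorem containsCycle_four_of_common_neighbors {V : Type*} {G : SimpleGraph V} {u v a b : V}
    (huv : u ≠ v) (hab : a ≠ b) (hua : G.Adj u a) (hva : G.Adj v a) (hub : G.Adj u b)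
    (hvb : G.Adj v b) : ContainsCycle 4 G := by
  refine ⟨⟨⟨![u, a, v, b], ?_⟩, ?_⟩⟩
  · intro i j hij
    rw [SimpleGraph.cycleGraph_adj] at hij
    fin_cases i <;> fin_cases j <;>
      first
      | exact absurd hij (by decide)
      | simp [hua, hva, hub, hvb, hua.symm, hva.symm, hub.symm, hvb.symm]
  · intro i j hij
    have := hua.ne
    have := hva.ne
    have := hub.ne
    have := hvb.ne
    fin_cases i <;> fin_cases j <;> simp_all

/-- Vertices with many neighbours in a small set `S` are few, by inclusion-exclusion. -/
theorem card_mul_le_card_biUnion (hH : AtMostOneCommonNeighbor H) {k : ℕ} (S B : Finset V)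
    (hB : ∀ v ∈ B, 2 * k ≤ (H.neighborFinset v ∩ S).card) (hk : B.card ≤ k) :
    B.card * (k + 1) ≤ (B.biUnion fun v => H.neighborFinset v ∩ S).card := by
  induction B using Finset.induction_on with
  | empty => simp
  | insert v B hv ih =>
    rw [card_insert_of_notMem hv] at hk ⊢
    have ih' := ih (fun u hu => hB u (mem_insert_of_mem hu)) (by omega)
    set W := B.biUnion fun v => H.neighborFinset v ∩ S with hW
    -- Each earlier neighbourhood shares at most one vertex with that of `v`, so `v` contributes at
    -- least 2k - (k - 1) = k + 1 new points.
    have hint : ((H.neighborFinset v ∩ S) ∩ W).card ≤ B.card := by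
      rw [hW, inter_biUnion]
      refine (card_biUnion_le_card_mul _ _ 1 fun u hu => card_le_one.2 ?_).trans (by simp)
      intro a ha b hb
      simp only [mem_inter, SimpleGraph.mem_neighborFinset] at ha hb
      exact hH v u a b (fun h => hv (h ▸ hu)) ha.1.1 ha.2.1 hb.1.1 hb.2.1
    have hv2 := hB v (mem_insert_self _ _)
    have hun := card_union_add_card_inter (H.neighborFinset v ∩ S) W
    rw [biUnion_insert, ← hW, add_mul]
    omega

/-- Otherwise k such vertices would cover k(k + 1) > k² points of `S`. -/
theorem card_filter_many_neighbors_lt (hH : AtMostOneCommonNeighbor H) {k : ℕ} (hk : 0 < k)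
    (S : Finset V) (hS : S.card ≤ k ^ 2) :
    (univ.filter fun v => 2 * k ≤ (H.neighborFinset v ∩ S).card).card < k := by
  by_contra! h
  obtain ⟨B, hBsub, hBcard⟩ := exists_subset_card_eq h
  have h1 := card_mul_le_card_biUnion H hH S B (fun v hv => (mem_filter.1 (hBsub hv)).2) hBcard.le
  have h2 : (B.biUnion fun v => H.neighborFinset v ∩ S).card ≤ S.card :=
    card_le_card (biUnion_subset.2 fun _ _ => inter_subset_right)
  rw [hBcard] at h1
  nlinarith

/-- `f` lists the vertices of a self-avoiding walk in `H`, in order. -/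
def IsSelfAvoidingWalk {V : Type*} (H : SimpleGraph V) {n : ℕ} (f : Fin n → V) : Prop :=
  Function.Injective f ∧ ∀ i j : Fin n, i.val + 1 = j.val → H.Adj (f i) (f j)

theorem IsSelfAvoidingWalk.cons {V : Type*} {H : SimpleGraph V} {n : ℕ} {f : Fin (n + 1) → V}
    (hf : IsSelfAvoidingWalk H f) {v : V} (hadj : H.Adj v (f 0)) (hv : v ∉ Set.range f) :
    IsSelfAvoidingWalk H (Fin.cons v f : Fin (n + 2) → V) := by
  refine ⟨Fin.cons_injective_iff.2 ⟨hv, hf.1⟩, fun i j hij => ?_⟩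
  induction j using Fin.cases with
  | zero => simp at hij
  | succ j =>
    induction i using Fin.cases with
    | zero =>
      have : j = 0 := by ext; simpa using hij.symm
      subst this
      simpa using hadj
    | succ i =>
      simp only [Fin.cons_succ]
      exact hf.2 i j (by simpa using hij)

open Classical in
/-- Self-avoiding walks whose initial vertex has few neighbours on the walk. -/
noncomputable def extendableWalks (k t : ℕ) : Finset (Fin (t + 1) → V) :=
  univ.filter fun f => IsSelfAvoidingWalk H f ∧
    (H.neighborFinset (f 0) ∩ univ.image f).card < 2 * k

theorem isSelfAvoidingWalk_of_mem_extendableWalks {k t : ℕ} {f : Fin (t + 1) → V}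
    (hf : f ∈ extendableWalks H k t) : IsSelfAvoidingWalk H f := by
  simp only [extendableWalks, mem_filter] at hf
  exact hf.2.1

/-- Walks grow at their initial vertex. Of its 4k or more neighbours, fewer than 2k lie on the walk
and fewer than k would violate the invariant, so at least k extensions remain. -/
theorem pow_le_card_extendableWalks (hH : AtMostOneCommonNeighbor H) {k : ℕ} (hk : 0 < k)
    (hdeg : ∀ v, 4 * k ≤ H.degree v) (hV : k ≤ Fintype.card V) (t : ℕ) (ht : t ≤ k ^ 2) :
    k ^ (t + 1) ≤ (extendableWalks H k t).card := by
  induction t with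
  | zero =>
    have hsub : Subsingleton (Fin (0 + 1)) := inferInstanceAs (Subsingleton (Fin 1))
    have : extendableWalks H k 0 = univ := by
      ext f
      simp only [extendableWalks, mem_filter, mem_univ, true_and, iff_true]
      refine ⟨⟨Function.injective_of_subsingleton f, fun i j hij => by omega⟩, ?_⟩
      have : H.neighborFinset (f 0) ∩ univ.image f = ∅ := by
        ext u
        simp only [mem_inter, SimpleGraph.mem_neighborFinset, mem_image, mem_univ, true_and,
          notMem_empty, iff_false, not_and, not_exists]
        rintro hu i rfl
        rw [Subsingleton.elim i 0] at hu
        exact H.loopless.irrefl _ hu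
      rw [this, card_empty]
      omega
    rw [this]
    simpa using hV
  | succ t ih =>
    have ih' := ih (by omega)
    let many (f : Fin (t + 1) → V) : Finset V :=
      univ.filter fun v => 2 * k ≤ (H.neighborFinset v ∩ univ.image f).card
    let choices (f : Fin (t + 1) → V) : Finset V :=
      H.neighborFinset (f 0) \ ((H.neighborFinset (f 0) ∩ univ.image f) ∪ many f)
    have hchoices : ∀ f ∈ extendableWalks H k t, k ≤ (choices f).card := by
      intro f hf
      simp only [extendableWalks, mem_filter, mem_univ, true_and] at hf
      have h1 := le_card_sdiff ((H.neighborFinset (f 0) ∩ univ.image f) ∪ many f)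
        (H.neighborFinset (f 0))
      have h2 := card_union_le (H.neighborFinset (f 0) ∩ univ.image f) (many f)
      have h3 : (many f).card < k := card_filter_many_neighbors_lt H hH hk _
        (card_image_le.trans (by simpa using ht))
      have h4 := hdeg (f 0)
      rw [← SimpleGraph.card_neighborFinset_eq_degree] at h4
      have h5 := hf.2
      change k ≤ (H.neighborFinset (f 0) \ _).card
      omega
    calc k ^ (t + 1 + 1) = k ^ (t + 1) * k := pow_succ _ _
      _ ≤ (extendableWalks H k t).card * k := Nat.mul_le_mul_right _ ih'
      _ ≤ ∑ f ∈ extendableWalks H k t, (choices f).card := by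
        rw [← smul_eq_mul]
        exact card_nsmul_le_sum _ _ _ hchoices
      _ = ((extendableWalks H k t).sigma choices).card := (card_sigma _ _).symm
      _ ≤ (extendableWalks H k (t + 1)).card := by
        refine card_le_card_of_injOn (fun p => Fin.cons p.2 p.1) ?_ ?_
        · rintro ⟨f, v⟩ hp
          simp only [coe_sigma, Set.mem_sigma_iff, mem_coe, extendableWalks, mem_filter, mem_univ,
            true_and, choices, many, mem_sdiff, mem_union, mem_inter, not_or, not_and, not_le,
            SimpleGraph.mem_neighborFinset] at hp
          obtain ⟨⟨hf, -⟩, hadj, hnot, hfew⟩ := hp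
          have hv := hnot hadj
          simp only [mem_coe, extendableWalks, mem_filter, mem_univ, true_and]
          -- The new vertex is not its own neighbour, so lengthening the walk by it does not raise
          -- its count.
          refine ⟨hf.cons hadj.symm (by simpa using hv), lt_of_le_of_lt (card_le_card ?_) hfew⟩
          intro u hu
          simp only [mem_inter, SimpleGraph.mem_neighborFinset, mem_image, mem_univ, true_and,
            Fin.cons_zero] at hu ⊢
          obtain ⟨hvu, i, rfl⟩ := hu
          refine ⟨hvu, ?_⟩
          induction i using Fin.cases with
          | zero => exact absurd hvu (H.loopless.irrefl _)
          | succ i => exact ⟨i, by simp⟩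
        · rintro ⟨f, v⟩ - ⟨g, w⟩ - h
          obtain ⟨h1, h2⟩ := Fin.cons_injective2 h
          cases h1
          cases h2
          rfl

end SelfAvoidingWalks

/-- Each injection of `Fin n` into the vertices of `H` pulls `H` back to a graph which contains at
most one member of the family. -/
theorem IsSeparatedFamily.card_mul_card_le {V : Type*} [Fintype V] (H : SimpleGraph V)
    {n : ℕ} {F : Finset (SimpleGraph (Fin n))}
    (hF : IsSeparatedFamily n 4 F) (hH : AtMostOneCommonNeighbor H)
    (A : Finset (Fin n → V)) (hA : ∀ f ∈ A, IsSelfAvoidingWalk H f) :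
    F.card * A.card ≤ Fintype.card V ^ n := by
  classical
  let e (G : F) : SimpleGraph.pathGraph n ≃g G.1 := (hF.1 G.1 G.2).some
  have key : ∀ (G : F) (f : Fin n → V), f ∈ A → ∀ x y, G.1.Adj x y →
      H.Adj (f ((e G).symm x)) (f ((e G).symm y)) := by
    intro G f hf x y hxy
    have hpath := (e G).symm.map_adj_iff.2 hxy
    rw [SimpleGraph.pathGraph_adj] at hpath
    rcases hpath with h | h
    · exact (hA f hf).2 _ _ h
    · exact ((hA f hf).2 _ _ h).symm
  have hcard : (F.attach ×ˢ A).card ≤ (univ : Finset (Fin n → V)).card := by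
    refine card_le_card_of_injOn (fun p => p.2 ∘ (e p.1).symm) (fun _ _ => mem_coe.2 (mem_univ _)) ?_
    rintro ⟨G, f⟩ hp ⟨G', f'⟩ hp' h
    have hf : f ∈ A := (mem_product.1 hp).2
    have hf' : f' ∈ A := (mem_product.1 hp').2
    have happ : ∀ x, f' ((e G').symm x) = f ((e G).symm x) := fun x => (congrFun h x).symm
    have hinj : Function.Injective fun x => f ((e G).symm x) :=
      (hA f hf).1.comp (e G).symm.injective
    have hadj : ∀ x y, (G.1 ⊔ G'.1).Adj x y → H.Adj (f ((e G).symm x)) (f ((e G).symm y)) := by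
      rintro x y (hxy | hxy)
      · exact key G f hf x y hxy
      · have := key G' f' hf' x y hxy
        rwa [happ, happ] at this
    have hG : G = G' := by
      by_contra hne
      obtain ⟨u, v, a, b, huv, hab, hua, hva, hub, hvb⟩ :=
        (hF.2 G.1 G.2 G'.1 G'.2 fun h => hne (Subtype.ext h)).exists_common_neighbors
      exact hab (hinj (hH _ _ _ _ (hinj.ne huv) (hadj _ _ hua) (hadj _ _ hva) (hadj _ _ hub)
        (hadj _ _ hvb)))
    subst hG
    have hff : f = f' := by
      funext i
      simpa using (happ (e G i)).symm
    rw [hff]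
  simpa using hcard

/-! ### A dense host graph without 4-cycles -/

section PolarityGraph

/-- The polarity graph of the affine plane over `ZMod q`. -/
def polarityGraph (q : ℕ) : SimpleGraph (ZMod q × ZMod q) where
  Adj u v := u ≠ v ∧ u.2 + v.2 = u.1 * v.1
  symm := ⟨fun u v h => ⟨h.1.symm, by rw [add_comm, mul_comm]; exact h.2⟩⟩
  loopless := ⟨fun _ h => h.1 rfl⟩

instance (q : ℕ) : DecidableRel (polarityGraph q).Adj :=
  fun u v => inferInstanceAs (Decidable (u ≠ v ∧ u.2 + v.2 = u.1 * v.1))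

theorem atMostOneCommonNeighbor_polarityGraph (q : ℕ) [Fact q.Prime] :
    AtMostOneCommonNeighbor (polarityGraph q) := by
  rintro ⟨u1, u2⟩ ⟨v1, v2⟩ ⟨a1, a2⟩ ⟨b1, b2⟩ huv ⟨-, hua⟩ ⟨-, hva⟩ ⟨-, hub⟩ ⟨-, hvb⟩
  simp only at hua hva hub hvb
  have h : (u1 - v1) * (a1 - b1) = 0 := by linear_combination -hua + hva + hub - hvb
  rcases mul_eq_zero.1 h with h | h
  · rw [sub_eq_zero] at h
    subst h
    refine absurd ?_ huv
    rw [Prod.mk.injEq]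
    exact ⟨rfl, by linear_combination hua - hva⟩
  · rw [sub_eq_zero] at h
    subst h
    rw [Prod.mk.injEq]
    exact ⟨rfl, by linear_combination hua - hub⟩

theorem le_degree_polarityGraph (q : ℕ) [Fact q.Prime] (v : ZMod q × ZMod q) :
    q - 1 ≤ (polarityGraph q).degree v := by
  rw [← SimpleGraph.card_neighborFinset_eq_degree]
  -- The vertex `v` may itself satisfy the equation, which costs one neighbour.
  have hsub : (univ.image fun a : ZMod q => (a, v.1 * a - v.2)).erase v ⊆
      (polarityGraph q).neighborFinset v := by
    intro u hu
    simp only [mem_erase, mem_image, mem_univ, true_and] at hu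
    obtain ⟨hne, a, rfl⟩ := hu
    rw [SimpleGraph.mem_neighborFinset]
    exact ⟨hne.symm, by simp⟩
  refine le_trans ?_ (card_le_card hsub)
  have hcard : (univ.image fun a : ZMod q => (a, v.1 * a - v.2)).card = q := by
    rw [card_image_of_injective _ fun a b h => (Prod.mk.inj h).1, card_univ, ZMod.card]
  exact (Nat.sub_le_sub_right hcard.ge 1).trans pred_card_le_card_erase

end PolarityGraph

/-! ### Bounds on `maxSeparated` -/

theorem IsSeparatedFamily.card_le {n k : ℕ} {F : Finset (SimpleGraph (Fin n))}
    (hF : IsSeparatedFamily n 4 F) (hn : 0 < n) (hk : 0 < k) (hnk : n ≤ k ^ 2) :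
    F.card ≤ (64 * k) ^ n := by
  obtain ⟨q, hq, hlt, hle⟩ := Nat.exists_prime_lt_and_le_two_mul (4 * k) (by omega)
  have : Fact q.Prime := ⟨hq⟩
  obtain ⟨t, rfl⟩ : ∃ t, n = t + 1 := ⟨n - 1, by omega⟩
  have hcard : Fintype.card (ZMod q × ZMod q) = q * q := by simp [ZMod.card]
  have h1 := pow_le_card_extendableWalks (polarityGraph q)
    (atMostOneCommonNeighbor_polarityGraph q) hk
    (fun v => le_trans (by omega) (le_degree_polarityGraph q v))
    (by rw [hcard]; nlinarith) t (by omega)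
  have h2 := hF.card_mul_card_le (polarityGraph q) (atMostOneCommonNeighbor_polarityGraph q)
    (extendableWalks (polarityGraph q) k t) fun f hf => isSelfAvoidingWalk_of_mem_extendableWalks _ hf
  rw [hcard] at h2
  have h3 : F.card * k ^ (t + 1) ≤ (64 * k) ^ (t + 1) * k ^ (t + 1) := by
    calc F.card * k ^ (t + 1) ≤ (q * q) ^ (t + 1) := (Nat.mul_le_mul_left _ h1).trans h2
      _ ≤ (64 * k * k) ^ (t + 1) := Nat.pow_le_pow_left (by nlinarith) _
      _ = _ := mul_pow _ _ _
  exact Nat.le_of_mul_le_mul_right h3 (pow_pos hk _)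

theorem maxSeparated_four_le {n k : ℕ} (hn : 0 < n) (hk : 0 < k) (hnk : n ≤ k ^ 2) :
    maxSeparated n 4 ≤ (64 * k) ^ n := by
  refine csSup_le ⟨0, ∅, ⟨by simp, by simp⟩, rfl⟩ ?_
  rintro m ⟨F, hF, rfl⟩
  exact hF.card_le hn hk hnk

theorem IsSeparatedFamily.card_le_maxSeparated {n k : ℕ} {F : Finset (SimpleGraph (Fin n))}
    (hF : IsSeparatedFamily n k F) : F.card ≤ maxSeparated n k := by
  classical
  refine le_csSup ⟨Fintype.card (SimpleGraph (Fin n)), ?_⟩ ⟨F, hF, rfl⟩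
  rintro m ⟨F', -, rfl⟩
  exact card_le_univ F'

/-! ### The lower bound construction -/

section AlternatingPaths

/-- The embedding of `Fin (n / 2)` onto the odd positions. -/
def oddPosition (n : ℕ) : Fin (n / 2) ↪ Fin n where
  toFun j := ⟨2 * j.val + 1, by omega⟩
  inj' i j h := by
    simp only [Fin.mk.injEq] at h
    ext
    omega

/-- The Hamilton path which visits the even vertices in their order and permutes the odd ones. -/
noncomputable def alternatingPath (n : ℕ) (σ : Equiv.Perm (Fin (n / 2))) : SimpleGraph (Fin n) :=
  (SimpleGraph.pathGraph n).map (σ.viaEmbedding (oddPosition n)).toEmbedding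

theorem isHamiltonPath_alternatingPath (n : ℕ) (σ : Equiv.Perm (Fin (n / 2))) :
    IsHamiltonPath (alternatingPath n σ) :=
  ⟨SimpleGraph.Iso.map _ _⟩

theorem alternatingPath_adj (n : ℕ) (σ : Equiv.Perm (Fin (n / 2))) (x y : Fin n) :
    (alternatingPath n σ).Adj (σ.viaEmbedding (oddPosition n) x)
      (σ.viaEmbedding (oddPosition n) y) ↔ (SimpleGraph.pathGraph n).Adj x y :=
  SimpleGraph.map_adj_apply

theorem viaEmbedding_oddPosition_even (n : ℕ) (σ : Equiv.Perm (Fin (n / 2))) (x : Fin n)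
    (hx : Even x.val) : σ.viaEmbedding (oddPosition n) x = x := by
  refine Equiv.Perm.viaEmbedding_apply_of_notMem _ _ _ ?_
  rintro ⟨j, rfl⟩
  have : ¬ Even (2 * j.val + 1) := by simp
  exact this hx

/-- The vertex at the odd position `2j + 1` is the only common neighbour of its two neighbours. -/
theorem alternatingPath_common_neighbor_iff (n : ℕ) (σ : Equiv.Perm (Fin (n / 2)))
    (j : Fin (n / 2)) (a b : Fin n) (ha : a.val = 2 * j.val) (hb : b.val = 2 * j.val + 2)
    (x : Fin n) : (alternatingPath n σ).Adj a x ∧ (alternatingPath n σ).Adj b x ↔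
      x = oddPosition n (σ j) := by
  obtain ⟨y, rfl⟩ := (σ.viaEmbedding (oddPosition n)).surjective x
  have h1 := alternatingPath_adj n σ a y
  have h2 := alternatingPath_adj n σ b y
  rw [viaEmbedding_oddPosition_even n σ a (ha ▸ even_two_mul _)] at h1
  rw [viaEmbedding_oddPosition_even n σ b (hb ▸ (even_two_mul _).add even_two)] at h2
  rw [h1, h2, ← Equiv.Perm.viaEmbedding_apply, EmbeddingLike.apply_eq_iff_eq,
    SimpleGraph.pathGraph_adj, SimpleGraph.pathGraph_adj, Fin.ext_iff]
  have hj : (oddPosition n j).val = 2 * j.val + 1 := rfl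
  omega

/-- Distinct permutations differ in at least two places. The last index must be avoided: for even n,
the last odd position ends the path and has only one neighbour. -/
theorem exists_ne_of_perm_ne {m : ℕ} {σ τ : Equiv.Perm (Fin m)} (h : σ ≠ τ) :
    ∃ j : Fin m, j.val + 1 < m ∧ σ j ≠ τ j := by
  obtain ⟨j, hj⟩ : ∃ j, σ j ≠ τ j := by
    by_contra! h'
    exact h (Equiv.ext h')
  by_cases hjm : j.val + 1 < m
  · exact ⟨j, hjm, hj⟩
  have hi : σ (σ.symm (τ j)) = τ j := σ.apply_symm_apply _
  have hij : σ.symm (τ j) ≠ j := fun h' => hj (by rw [h'] at hi; exact hi)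
  refine ⟨σ.symm (τ j), ?_, ?_⟩
  · have := Fin.val_ne_of_ne hij
    omega
  · rw [hi]
    exact τ.injective.ne hij.symm

theorem exists_common_neighbors_of_perm_ne {n : ℕ} {σ τ : Equiv.Perm (Fin (n / 2))}
    (h : σ ≠ τ) : ∃ a b x y : Fin n, a ≠ b ∧ x ≠ y ∧
      (∀ z, (alternatingPath n σ).Adj a z ∧ (alternatingPath n σ).Adj b z ↔ z = x) ∧
      ∀ z, (alternatingPath n τ).Adj a z ∧ (alternatingPath n τ).Adj b z ↔ z = y := by
  obtain ⟨j, hj, hne⟩ := exists_ne_of_perm_ne h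
  exact ⟨⟨2 * j.val, by omega⟩, ⟨2 * j.val + 2, by omega⟩, oddPosition n (σ j),
    oddPosition n (τ j), by simp, (oddPosition n).injective.ne hne,
    alternatingPath_common_neighbor_iff n σ j _ _ rfl rfl,
    alternatingPath_common_neighbor_iff n τ j _ _ rfl rfl⟩

theorem alternatingPath_injective (n : ℕ) : Function.Injective (alternatingPath n) := by
  intro σ τ h
  by_contra hne
  obtain ⟨a, b, x, y, -, hxy, hx, hy⟩ := exists_common_neighbors_of_perm_ne hne
  rw [h] at hx
  exact hxy ((hy x).1 ((hx x).2 rfl))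

theorem factorial_le_maxSeparated_four (n : ℕ) :
    Nat.factorial (n / 2) ≤ maxSeparated n 4 := by
  classical
  have hF : IsSeparatedFamily n 4 (univ.image (alternatingPath n)) := by
    refine ⟨?_, ?_⟩
    · simp only [mem_image, mem_univ, true_and, forall_exists_index, forall_apply_eq_imp_iff]
      exact isHamiltonPath_alternatingPath n
    · simp only [mem_image, mem_univ, true_and, forall_exists_index, forall_apply_eq_imp_iff]
      intro σ τ hne
      obtain ⟨a, b, x, y, hab, hxy, hx, hy⟩ :=
        exists_common_neighbors_of_perm_ne fun h : σ = τ => hne (h ▸ rfl)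
      have hx' := (hx x).2 rfl
      have hy' := (hy y).2 rfl
      exact containsCycle_four_of_common_neighbors hab hxy (Or.inl hx'.1) (Or.inl hx'.2)
        (Or.inr hy'.1) (Or.inr hy'.2)
  have h := hF.card_le_maxSeparated
  rwa [card_image_of_injective _ (alternatingPath_injective n), card_univ, Fintype.card_perm,
    Fintype.card_fin] at h

end AlternatingPaths

/-! ### Asymptotic form of the upper bound -/

theorem maxSeparated_four_le_rpow (n : ℕ) (hn : 2 ≤ n) :
    (maxSeparated n 4 : ℝ) ≤
      (n : ℝ) ^ (3 * (n : ℝ) / 4 + Real.log 128 * ((n : ℝ) / Real.log (n : ℝ))) := by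
  have hn1 : (1 : ℝ) < n := by exact_mod_cast hn
  have hn0 : (0 : ℝ) < n := by linarith
  have hlog : Real.log n ≠ 0 := (Real.log_pos hn1).ne'
  have hsqrt : ((Nat.sqrt n + 1 : ℕ) : ℝ) ≤ 2 * Real.sqrt n := by
    have h1 := Real.nat_sqrt_le_real_sqrt (a := n)
    have h2 : (1 : ℝ) ≤ Real.sqrt n := Real.one_le_sqrt.2 hn1.le
    push_cast
    linarith
  have hnat := maxSeparated_four_le (n := n) (k := Nat.sqrt n + 1) (by omega) (by omega)
    (Nat.lt_succ_sqrt' n).le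
  have hexp : (n : ℝ) ^ (Real.log 128 * ((n : ℝ) / Real.log (n : ℝ))) = (128 : ℝ) ^ (n : ℝ) := by
    rw [Real.rpow_def_of_pos hn0, Real.rpow_def_of_pos (by norm_num)]
    congr 1
    field_simp
  calc (maxSeparated n 4 : ℝ) ≤ (64 * ((Nat.sqrt n + 1 : ℕ) : ℝ)) ^ n := by exact_mod_cast hnat
    _ ≤ (128 * Real.sqrt n) ^ n := by
      refine pow_le_pow_left₀ (by positivity) ?_ n
      linarith
    _ = (n : ℝ) ^ ((n : ℝ) / 2) * (128 : ℝ) ^ (n : ℝ) := by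
      rw [mul_pow, mul_comm, Real.rpow_natCast, Real.sqrt_eq_rpow, ← Real.rpow_natCast,
        ← Real.rpow_mul hn0.le]
      congr 2
      ring
    -- The exponent n/2 is weakened to the stated 3n/4 only here.
    _ ≤ (n : ℝ) ^ (3 * (n : ℝ) / 4) * (128 : ℝ) ^ (n : ℝ) := by
      refine mul_le_mul_of_nonneg_right ?_ (by positivity)
      exact Real.rpow_le_rpow_of_exponent_le hn1.le (by linarith)
    _ = _ := by rw [Real.rpow_add hn0, hexp]

theorem theorem2 :
    (∀ n : ℕ, 1 ≤ n → Nat.factorial (n / 2) ≤ maxSeparated n 4) ∧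
    ∃ C : ℝ, ∀ n : ℕ, 2 ≤ n →
      (maxSeparated n 4 : ℝ) ≤
        (n : ℝ) ^ (3 * (n : ℝ) / 4 + C * ((n : ℝ) / Real.log (n : ℝ))) :=
  ⟨fun n _ => factorial_le_maxSeparated_four n, Real.log 128, maxSeparated_four_le_rpow⟩
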